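/- **Setting.** Let $\mathcal G$ be a causal diagram (directed acyclic edges and bidirected edges) over a finite set $\mathbf V$ of variables with finite domains. A structural causal model (SCM) compatible with $\mathcal G$ has mechanisms $v\leftarrow f_v(pa_v,u_v)$ and a law $P(\mathbf U)$ such that $\mathbf U_{\mathbf A}$ and $\mathbf U_{\mathbf B}$ are independent whenever $\mathbf A,\mathbf B\subseteq\mathbf V$ are disjoint with no bidirected edge between them. Consider a target SCM $\mathcal M^*$ and source SCMs $\mathcal M^1,\dots,\mathcal M^n$, all compatible with $\mathcal G$, and discrepancy sets $\Delta^1,\dots,\Delta^n\subseteq\mathbf V$ such that $f_v^i=f_v^*$ for all $v\notin\Delta^i$ and the law of $(U_v)_{v\notin\Delta^i}$ is the same in $\mathcal M^i$ and $\mathcal M^*$. From source $i$ the distributions $P^i_{\mathbf z}$, $\mathbf Z\in\mathbb Z^i$, $\mathbf z\in\Omega_{\mathbf Z}$, are available. Write $Q[\mathbf C](\mathbf v)=P_{\mathbf v\setminus\mathbf c}(\mathbf c)$, with superscript $*$ or $i$ for the model. $Q[\mathbf C']$ is *identifiable from source $i$* if any two SCMs compatible with $\mathcal G$ with $P(\mathbf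 v)>0$ for all $\mathbf v$ that agree on $P_{\mathbf z}$ for all $\mathbf Z\in\mathbb Z^i$ and all $\mathbf z$ agree on $Q[\mathbf C']$. $Q^i[\mathbf C]$ is a *source counterpart* of $Q^*[\mathbf C]$ if $\mathbf C\cap\Delta^i=\emptyset$ and $Q[\mathbf C]$ is identifiable from source $i$. Let $Y\in\mathbf V$ be a reward variable with nonnegative values, $\mathbf X\subseteq\mathbf V\setminus\{Y\}$, $\mathbf x\in\Omega_{\mathbf X}$, $\mathbf Y^+=\mathrm{An}(Y)_{\mathcal G_{\underline{\mathbf X}}}$ (the ancestors of $Y$, including $Y$, after deleting the edges out of $\mathbf X$), and let $\mathbf C_1,\dots,\mathbf C_m$ be the c-components of $\mathcal G[\mathbf Y^+]$. A *source choice* assigns to each $q$ a source $i_q$ with $\mathbf C_q\cap\Delta^{i_q}=\emptyset$ and a set $\mathbf C'_q\supseteq\mathbf C_q$ such that $Q[\mathbf C'_q]$ is identifiable from source $i_q$, where $\mathbf C'_q=\mathbf C_q$ whenever $Q^*[\mathbf C_q]$ has a source counterpart; and, for each $\mathbf y^+$, values of the variables outside $\mathbf X\cup\mathbf Y^+$ at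 which $Q^{i_q}[\mathbf C'_q]$ is evaluated together with $\mathbf x,\mathbf y^+$. Put $L_q=Q^{i_q}[\mathbf C'_q]$, and $U_q=Q^{i_q}[\mathbf C_q]$ if $\mathbf C'_q=\mathbf C_q$, $U_q=Q^{i_q}[\mathbf C'_q]+1-\sum_{\mathbf c_q}Q^{i_q}[\mathbf C'_q]$ otherwise. **Theorem.** 1. $\mathbb E_{P^*_{\mathbf x}}Y=\sum_y y\,P^*_{\mathbf x}(y)=\sum_{\mathbf y^+}y\prod_{q=1}^m Q^*[\mathbf C_q]$ (for any values of the variables outside $\mathbf X\cup\mathbf Y^+$). 2. If $Q^i[\mathbf C_q]$ is a source counterpart, then $Q^*[\mathbf C_q]=Q^i[\mathbf C_q]$, and $Q^*[\mathbf C_q]$ is transportable: any two collections of SCMs as above, with positive sources and the same available source distributions, have the same $Q^*[\mathbf C_q]$. 3. For every source choice, $L_q\le Q^*[\mathbf C_q]\le U_q$ for all $q$ and all $\mathbf y^+$, and $$\sum_{\mathbf y^+}y\prod_{q}L_q\;\le\;\mathbb E_{P^*_{\mathbf x}}Y\;\le\;\sum_y y\,\min\Big\{1,\sum_{\mathbf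 y^+\setminus\{y\}}\prod_q U_q\Big\}.$$ 4. Let $\ell_{\mathbf x}$ be the maximum of $0$ and all these lower bounds, and $u_{\mathbf x}$ the minimum of all these upper bounds ($\infty$ if there is no source choice). Then $\ell_{\mathbf x}\le\mathbb E_{P^*_{\mathbf x}}Y\le u_{\mathbf x}$, and if $Y\le1$ then also $\mathbb E_{P^*_{\mathbf x}}Y\le\min\{1,u_{\mathbf x}\}$. 5. The bounds are functions of the available source distributions: any two collections of SCMs as above, with positive sources and the same available source distributions, have the same $\ell_{\mathbf x}$ and $u_{\mathbf x}$. -/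

import Mathlib

open MeasureTheory ProbabilityTheory Finset
open scoped Classical

noncomputable section

/-- A (semi-Markovian) causal diagram: directed edges `dir a b` (`a → b`) without directed cycles,
and bidirected edges `bidir a b` (`a ↔ b`). -/
structure CausalDiagram (V : Type*) where
  dir : V → V → Prop
  bidir : V → V → Prop
  bidir_symm : ∀ a b, bidir a b → bidir b a
  acyclic : ∀ a, ¬ Relation.TransGen dir a a

/-- A collective selection diagram for `n` source environments: a causal diagram and, for each
source `i`, the set `Δ i` of variables pointed to by the selection nodes of source `i`, i.e. the
variables whose mechanism may differ between source `i` and the target. -/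
structure SelectionDiagram (V : Type*) (n : ℕ) extends CausalDiagram V where
  Δ : Fin n → Finset V

namespace CausalDiagram

variable {V : Type*} (G : CausalDiagram V)

theorem dir_wf [Finite V] : WellFounded G.dir := by
  have h : WellFounded (Relation.TransGen G.dir) := by
    have : Std.Irrefl (Relation.TransGen G.dir) := ⟨G.acyclic⟩
    have : IsTrans V (Relation.TransGen G.dir) := ⟨fun _ _ _ => Relation.TransGen.trans⟩
    exact Finite.wellFounded_of_trans_of_irrefl _
  exact Subrelation.wf (fun h => Relation.TransGen.single h) h

/-- `An(Y)` in the diagram obtained from `G` by deleting every edge out of a vertex of `X`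
(`Y` itself is included). -/
def ancUnder [Fintype V] (X : Finset V) (Y : V) : Finset V :=
  univ.filter fun w => Relation.ReflTransGen (fun a b => G.dir a b ∧ a ∉ X) w Y

/-- The vertices of `S` that are joined to `w` by a bidirected path inside `S`. -/
def cComponent (S : Finset V) (w : V) : Finset V :=
  S.filter fun w' =>
    Relation.ReflTransGen (fun a b => a ∈ S ∧ b ∈ S ∧ G.bidir a b) w w'

/-- The (maximal) c-components of the induced subdiagram `G[S]`. -/
def cComponents (S : Finset V) : Finset (Finset V) :=
  S.image (G.cComponent S)

theorem self_mem_ancUnder [Fintype V] (X : Finset V) (Y : V) : Y ∈ G.ancUnder X Y := by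
  simp [ancUnder, Relation.ReflTransGen.refl]

end CausalDiagram

/-- The assignment that is `s` on `S` and `b` elsewhere. -/
def override {V : Type*} {D : V → Type*} (S : Finset V) (s : (w : S) → D w)
    (b : (v : V) → D v) : (v : V) → D v :=
  fun w => if h : w ∈ S then s ⟨w, h⟩ else b w

/-- A structural causal model compatible with the diagram `G`; the endogenous variable `v` takes
values in `D v`, and `E v` is the space of (the tuple of) the exogenous variables that enter the
mechanism of `v`.  `P` is the joint law of the exogenous variables; an exogenous variable shared by
several mechanisms occurs as (equal, hence dependent) parts of several coordinates.  Exogenous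
variables of groups of vertices without a bidirected edge between them are independent. -/
structure SCM {V : Type*} (G : CausalDiagram V) (D : V → Type*) (E : V → Type)
    [∀ v, MeasurableSpace (E v)] where
  f : (v : V) → ((w : {w // G.dir w v}) → D w) → E v → D v
  f_meas : ∀ v p d, MeasurableSet {e | f v p e = d}
  P : Measure ((v : V) → E v)
  prob : IsProbabilityMeasure P
  indep : ∀ A B : Finset V, Disjoint A B → (∀ a ∈ A, ∀ b ∈ B, ¬ G.bidir a b) →
    IndepFun (fun u (a : A) => u a) (fun u (b : B) => u b) P

namespace SCM

variable {V : Type*} [Fintype V] {G : CausalDiagram V} {D : V → Type*} {E : V → Type}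
  [∀ v, MeasurableSpace (E v)] (M : SCM G D E)

/-- The solution of the submodel under `do(X = x)` at the exogenous state `u`; only the coordinates
of `x` in `X` are used. -/
def response (X : Finset V) (x : (v : V) → D v) (u : (v : V) → E v) : (v : V) → D v :=
  G.dir_wf.fix fun v ih => if v ∈ X then x v else M.f v (fun w => ih w.1 w.2) (u v)

/-- The probability of the event `A` about the endogenous variables under `do(X = x)`. -/
def doProb (X : Finset V) (x : (v : V) → D v) (A : Set ((v : V) → D v)) : ℝ :=
  M.P.real {u | M.response X x u ∈ A}

/-- The c-factor `Q[C](v) = P_{v ∖ c}(c)`. -/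
def Q (C : Finset V) (v : (v : V) → D v) : ℝ :=
  M.doProb Cᶜ v {d | ∀ w ∈ C, d w = v w}

/-- The expected reward `∑_y y P_x(y)`, where `r y` is the numerical value of the state `y` of the
reward variable `Y`. -/
def expReward (Y : V) [Fintype (D Y)] (r : D Y → ℝ) (X : Finset V) (x : (v : V) → D v) : ℝ :=
  ∑ y, r y * M.doProb X x {d | d Y = y}

/-- Every value of the endogenous variables has positive observational probability. -/
def Positive : Prop := ∀ v : (v : V) → D v, 0 < M.doProb ∅ v {v}

/-- The two models have the same distributions `P_z` for every `Z ∈ 𝒵` and every value `z`. -/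
def SameExperiments {E' : V → Type} [∀ v, MeasurableSpace (E' v)] (𝒵 : Set (Finset V))
    (M : SCM G D E) (M' : SCM G D E') : Prop :=
  ∀ Z ∈ 𝒵, ∀ z v : (v : V) → D v, M.doProb Z z {v} = M'.doProb Z z {v}

end SCM

/-- The c-factor `Q[C]` is identifiable in `G` from the experiments `{P_z : Z ∈ 𝒵}`: any two
positive models compatible with `G` that agree on these experiments agree on `Q[C]`. -/
def Identifiable {V : Type*} [Fintype V] (G : CausalDiagram V) (D : V → Type*)
    (𝒵 : Set (Finset V)) (C : Finset V) : Prop :=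
  ∀ (E E' : V → Type) [∀ v, MeasurableSpace (E v)] [∀ v, MeasurableSpace (E' v)]
    (M : SCM G D E) (M' : SCM G D E'), M.Positive → M'.Positive →
    SCM.SameExperiments 𝒵 M M' → ∀ v, M.Q C v = M'.Q C v

/-- A collection of models (one target, `n` sources) that induces the selection diagram `𝒢`: all
models are compatible with the diagram, and outside `Δ i` the mechanisms and the law of their
exogenous variables in source `i` are those of the target. -/
structure Environments {V : Type*} {n : ℕ} (𝒢 : SelectionDiagram V n) (D : V → Type*) where
  E : V → Type
  mE : ∀ v, MeasurableSpace (E v)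
  target : SCM 𝒢.toCausalDiagram D E
  source : Fin n → SCM 𝒢.toCausalDiagram D E
  f_eq : ∀ i, ∀ v ∉ 𝒢.Δ i, (source i).f v = target.f v
  law_eq : ∀ i, (source i).P.map (fun u (w : {w // w ∉ 𝒢.Δ i}) => u w) =
    target.P.map (fun u (w : {w // w ∉ 𝒢.Δ i}) => u w)

attribute [instance] Environments.mE

section Bounds

variable {V : Type*} [Fintype V] {n : ℕ}

/-- The two collections have the same available source distributions `P^i_z`, `Z ∈ 𝒵 i`. -/
def Environments.SameData {𝒢 : SelectionDiagram V n} {D : V → Type*}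
    (𝒵 : Fin n → Set (Finset V)) (𝓜 𝓝 : Environments 𝒢 D) : Prop :=
  ∀ i, SCM.SameExperiments (𝒵 i) (𝓜.source i) (𝓝.source i)

/-- All source models are positive. -/
def Environments.Positive {𝒢 : SelectionDiagram V n} {D : V → Type*}
    (𝓜 : Environments 𝒢 D) : Prop :=
  ∀ i, (𝓜.source i).Positive

/-- The target c-factor `Q*[C]` is transportable: it is uniquely determined by the available source
distributions, over all collections of models that induce `𝒢`. -/
def Transportable (𝒢 : SelectionDiagram V n) (D : V → Type*) (𝒵 : Fin n → Set (Finset V))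
    (C : Finset V) : Prop :=
  ∀ 𝓜 𝓝 : Environments 𝒢 D, 𝓜.Positive → 𝓝.Positive → 𝓜.SameData 𝒵 𝓝 →
    ∀ v, 𝓜.target.Q C v = 𝓝.target.Q C v

/-- `Q^i[C]` is a source counterpart of `Q*[C]`: no mechanism of `C` is subject to a discrepancy in
source `i`, and `Q^i[C]` is identifiable from the experiments of source `i`. -/
def IsCounterpart (𝒢 : SelectionDiagram V n) (D : V → Type*) (𝒵 : Fin n → Set (Finset V))
    (i : Fin n) (C : Finset V) : Prop :=
  Disjoint C (𝒢.Δ i) ∧ Identifiable 𝒢.toCausalDiagram D (𝒵 i) C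

/-- The index set of the c-factors: the c-components of `G[Y⁺]`, `Y⁺ = An(Y)` in `G` with the edges
out of `X` deleted. -/
abbrev Factor (𝒢 : SelectionDiagram V n) (Y : V) (X : Finset V) : Type _ :=
  {C : Finset V // C ∈ 𝒢.cComponents (𝒢.ancUnder X Y)}

/-- The values `y⁺` of the variables in `Y⁺`. -/
abbrev YPlus (𝒢 : SelectionDiagram V n) (D : V → Type*) (Y : V) (X : Finset V) : Type _ :=
  (w : 𝒢.ancUnder X Y) → D w

/-- The coordinate `y` of `y⁺`. -/
def YPlus.reward {𝒢 : SelectionDiagram V n} {D : V → Type*} {Y : V} {X : Finset V}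
    (s : YPlus 𝒢 D Y X) : D Y :=
  s ⟨Y, 𝒢.self_mem_ancUnder X Y⟩

/-- A choice of source c-factors from which bounds for the action `do(X = x)` are formed.  For each
c-component `C`: a source `src C` without discrepancies in `C`, and a set `big C ⊇ C` whose
c-factor is identifiable from the experiments of that source.  If `Q*[C]` has a source counterpart,
then such a counterpart is used (`big C = C`).  As a c-factor `Q[big C]` may depend on
variables outside `X ∪ Y⁺`, `fill C` also chooses at which values of those it is evaluated. -/
structure SourceChoice (𝒢 : SelectionDiagram V n) (D : V → Type*) (𝒵 : Fin n → Set (Finset V))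
    (Y : V) (X : Finset V) (x : (v : V) → D v) where
  src : Factor 𝒢 Y X → Fin n
  big : Factor 𝒢 Y X → Finset V
  fill : Factor 𝒢 Y X → YPlus 𝒢 D Y X → (v : V) → D v
  subset_big : ∀ C, C.1 ⊆ big C
  disjoint_src : ∀ C, Disjoint C.1 (𝒢.Δ (src C))
  identifiable : ∀ C, Identifiable 𝒢.toCausalDiagram D (𝒵 (src C)) (big C)
  exact_of_counterpart : ∀ C, (∃ i, IsCounterpart 𝒢 D 𝒵 i C.1) → big C = C.1
  fill_action : ∀ C s, ∀ w ∈ X, fill C s w = x w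
  fill_yplus : ∀ C s, ∀ w : 𝒢.ancUnder X Y, fill C s w = s w

namespace SourceChoice

variable {𝒢 : SelectionDiagram V n} {D : V → Type*} [∀ v, Fintype (D v)]
  {𝒵 : Fin n → Set (Finset V)} {Y : V} {X : Finset V} {x : (v : V) → D v}
  (p : SourceChoice 𝒢 D 𝒵 Y X x) (𝓜 : Environments 𝒢 D)

/-- `Q^i[C]` for a source counterpart, and the lower bound `Q^i[C']` otherwise. -/
def lowerFactor (C : Factor 𝒢 Y X) (s : YPlus 𝒢 D Y X) : ℝ :=
  (𝓜.source (p.src C)).Q (p.big C) (p.fill C s)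

/-- `Q^i[C]` for a source counterpart, and the upper bound `Q^i[C'] + 1 - ∑_c Q^i[C']`
otherwise. -/
def upperFactor (C : Factor 𝒢 Y X) (s : YPlus 𝒢 D Y X) : ℝ :=
  if p.big C = C.1 then (𝓜.source (p.src C)).Q C.1 (p.fill C s)
  else (𝓜.source (p.src C)).Q (p.big C) (p.fill C s) + 1 -
    ∑ c : ((w : C.1) → D w), (𝓜.source (p.src C)).Q (p.big C) (override C.1 c (p.fill C s))

/-- The lower bound `∑_{y⁺} y ∏_q (lower factor)` for this choice of source c-factors. -/
def lower (r : D Y → ℝ) : ℝ :=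
  ∑ s : YPlus 𝒢 D Y X, r s.reward * ∏ C, p.lowerFactor 𝓜 C s

/-- The upper bound `∑_y y min{1, ∑_{y⁺ ∖ y} ∏_q (upper factor)}` for this choice. -/
def upper (r : D Y → ℝ) : ℝ :=
  ∑ y : D Y, r y * min 1 (∑ s : YPlus 𝒢 D Y X with s.reward = y, ∏ C, p.upperFactor 𝓜 C s)

end SourceChoice

variable {𝒢 : SelectionDiagram V n} {D : V → Type*} [∀ v, Fintype (D v)]

/-- The lower causal bound `ℓ_x`: the best lower bound over all choices of source c-factors
(`0` if there is no choice). -/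
def lowerCausalBound (𝓜 : Environments 𝒢 D) (𝒵 : Fin n → Set (Finset V)) (Y : V) (r : D Y → ℝ)
    (X : Finset V) (x : (v : V) → D v) : EReal :=
  max 0 (⨆ p : SourceChoice 𝒢 D 𝒵 Y X x, ((p.lower 𝓜 r : ℝ) : EReal))

/-- The upper causal bound `u_x`: the best upper bound over all choices of source c-factors
(`∞` if there is no choice). -/
def upperCausalBound (𝓜 : Environments 𝒢 D) (𝒵 : Fin n → Set (Finset V)) (Y : V) (r : D Y → ℝ)
    (X : Finset V) (x : (v : V) → D v) : EReal :=
  ⨅ p : SourceChoice 𝒢 D 𝒵 Y X x, ((p.upper 𝓜 r : ℝ) : EReal)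

end Bounds

end

/-!
The c-factor `Q[C](v)` is the probability that the exogenous variables `u` solve the mechanisms of
`C` at `v`, i.e. that `f_w (v restricted to pa(w)) (u w) = v w` for every `w ∈ C`
(`SCM.Q_eq_mechEvent`).  All claims are read off from this description.

* The event factors over any family of pairwise unconnected sets of vertices
  (`SCM.mechEvent_biUnion`), in particular over the c-components of `Y⁺`.  As `Y⁺` is disjoint
  from `X` and closed under parents outside `X`, the response to `do(X = x)` takes the value `y⁺`
  on `Y⁺` exactly when `u` solves the mechanisms of `Y⁺` (`SCM.mem_mechEvent_ancUnder_iff`).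
  Summing over `y⁺` gives the decomposition of the expected reward (`SCM.doProb_reward_eq_sum`).
* The event involves only the mechanisms and exogenous variables of `C`, so `Q[C]` is the same in
  the target and in every source without a discrepancy in `C` (`Environments.target_Q_eq_source_Q`).
* The event for `C' ⊇ C` is contained in the event for `C`, whence `Q[C'] ≤ Q[C]`; and the events
  for `C` at different values `c` are disjoint, so that `Q[C](v)` together with all
  `Q[C'](c, v ∖ c)`, `c ≠ v_C`, adds up to at most `1` (`SCM.Q_le_of_subset`, `SCM.Q_add_sum_le`).
  These give the bounds of the factors, and the bounds of the expected reward follow by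
  monotonicity of sums and products of nonnegative numbers.
* A source choice uses only c-factors that are identifiable from the data of their source, so its
  bounds are determined by these data.
-/

/-! ### Overriding an assignment -/

section Override

variable {V : Type*} {D : V → Type*}

theorem override_of_mem {S : Finset V} (s : (w : S) → D w) (b : (v : V) → D v) {w : V}
    (h : w ∈ S) : override S s b w = s ⟨w, h⟩ := by
  simp [override, h]

theorem override_of_notMem {S : Finset V} (s : (w : S) → D w) (b : (v : V) → D v) {w : V}
    (h : w ∉ S) : override S s b w = b w := by
  simp [override, h]

theorem override_restrict (S : Finset V) (b : (v : V) → D v) :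
    override S (fun w => b w) b = b := by
  funext w
  by_cases h : w ∈ S
  · rw [override_of_mem _ _ h]
  · rw [override_of_notMem _ _ h]

end Override

/-! ### Ancestors and c-components -/

namespace CausalDiagram

variable {V : Type*} (G : CausalDiagram V)

theorem notMem_of_mem_ancUnder [Fintype V] {X : Finset V} {Y w : V} (hY : Y ∉ X)
    (hw : w ∈ G.ancUnder X Y) : w ∉ X := by
  simp only [ancUnder, mem_filter, mem_univ, true_and] at hw
  rcases Relation.ReflTransGen.cases_head hw with rfl | ⟨_, h, _⟩
  · exact hY
  · exact h.2

theorem parent_mem_ancUnder [Fintype V] {X : Finset V} {Y w p : V}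
    (hw : w ∈ G.ancUnder X Y) (hp : G.dir p w) (hpX : p ∉ X) : p ∈ G.ancUnder X Y := by
  simp only [ancUnder, mem_filter, mem_univ, true_and] at hw ⊢
  exact Relation.ReflTransGen.head ⟨hp, hpX⟩ hw

theorem mem_cComponent {S : Finset V} {w a : V} : a ∈ G.cComponent S w ↔
    a ∈ S ∧ Relation.ReflTransGen (fun a b => a ∈ S ∧ b ∈ S ∧ G.bidir a b) w a := by
  simp [cComponent]

theorem cComponent_eq_of_mem {S : Finset V} {w a : V} (h : a ∈ G.cComponent S w) :
    G.cComponent S a = G.cComponent S w := by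
  rw [mem_cComponent] at h
  have hsymm : Relation.ReflTransGen (fun a b => a ∈ S ∧ b ∈ S ∧ G.bidir a b) a w := by
    have : Std.Symm fun a b => a ∈ S ∧ b ∈ S ∧ G.bidir a b :=
      ⟨fun a b hab => ⟨hab.2.1, hab.1, G.bidir_symm _ _ hab.2.2⟩⟩
    exact Relation.ReflTransGen.stdSymm.symm _ _ h.2
  ext c
  rw [mem_cComponent, mem_cComponent]
  exact ⟨fun hc => ⟨hc.1, h.2.trans hc.2⟩, fun hc => ⟨hc.1, hsymm.trans hc.2⟩⟩

theorem eq_cComponent_of_mem {S C : Finset V} (hC : C ∈ G.cComponents S) {a : V} (ha : a ∈ C) :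
    C = G.cComponent S a := by
  obtain ⟨w, -, rfl⟩ := mem_image.1 hC
  exact (G.cComponent_eq_of_mem ha).symm

theorem subset_of_mem_cComponents {S C : Finset V} (hC : C ∈ G.cComponents S) : C ⊆ S := by
  obtain ⟨w, -, rfl⟩ := mem_image.1 hC
  exact filter_subset _ _

theorem disjoint_of_mem_cComponents {S C C' : Finset V} (hC : C ∈ G.cComponents S)
    (hC' : C' ∈ G.cComponents S) (hne : C ≠ C') : Disjoint C C' := by
  rw [Finset.disjoint_left]
  intro a ha ha'
  exact hne ((G.eq_cComponent_of_mem hC ha).trans (G.eq_cComponent_of_mem hC' ha').symm)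

theorem not_bidir_of_mem_cComponents {S C C' : Finset V} (hC : C ∈ G.cComponents S)
    (hC' : C' ∈ G.cComponents S) (hne : C ≠ C') : ∀ a ∈ C, ∀ b ∈ C', ¬ G.bidir a b := by
  intro a ha b hb hab
  have haS := G.subset_of_mem_cComponents hC ha
  have hbS := G.subset_of_mem_cComponents hC' hb
  have hbC : b ∈ G.cComponent S a :=
    G.mem_cComponent.2 ⟨hbS, Relation.ReflTransGen.single ⟨haS, hbS, hab⟩⟩
  apply hne
  rw [G.eq_cComponent_of_mem hC ha, G.eq_cComponent_of_mem hC' hb, G.cComponent_eq_of_mem hbC]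

theorem biUnion_cComponents (S : Finset V) : (G.cComponents S).biUnion id = S := by
  ext a
  simp only [mem_biUnion, id]
  constructor
  · rintro ⟨C, hC, ha⟩
    exact G.subset_of_mem_cComponents hC ha
  · intro ha
    exact ⟨_, mem_image_of_mem _ ha, G.mem_cComponent.2 ⟨ha, Relation.ReflTransGen.refl⟩⟩

end CausalDiagram

/-! ### The mechanism event of a c-factor -/

namespace SCM

variable {V : Type*} {G : CausalDiagram V} {D : V → Type*} {E : V → Type}
  [∀ v, MeasurableSpace (E v)] (M : SCM G D E)

/-- The exogenous states at which the mechanism of every vertex of `C`, fed with the values `v` of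
its parents, returns the value prescribed by `v`. -/
def mechEvent (C : Finset V) (v : (v : V) → D v) : Set ((v : V) → E v) :=
  {u | ∀ w ∈ C, M.f w (fun p => v p) (u w) = v w}

theorem measurableSet_mechEvent (C : Finset V) (v : (v : V) → D v) :
    MeasurableSet (M.mechEvent C v) := by
  have : M.mechEvent C v =
      ⋂ w ∈ C, (fun u => u w) ⁻¹' {e | M.f w (fun p => v p) e = v w} := by
    ext u
    simp [mechEvent]
  rw [this]
  exact Finset.measurableSet_biInter _ fun w _ => measurable_pi_apply w (M.f_meas _ _ _)

theorem mechEvent_mono {C C' : Finset V} (h : C ⊆ C') (v : (v : V) → D v) :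
    M.mechEvent C' v ⊆ M.mechEvent C v :=
  fun _ hu w hw => hu w (h hw)

theorem mechEvent_congr {C : Finset V} {v v' : (v : V) → D v} (h : ∀ w ∈ C, v w = v' w)
    (hpa : ∀ w ∈ C, ∀ p, G.dir p w → v p = v' p) : M.mechEvent C v = M.mechEvent C v' := by
  ext u
  refine forall₂_congr fun w hw => ?_
  have : (fun p : {p // G.dir p w} => v p) = fun p : {p // G.dir p w} => v' p :=
    funext fun p => hpa w hw p p.2
  rw [this, h w hw]

theorem mechEvent_union {A B : Finset V} (hAB : Disjoint A B)
    (hb : ∀ a ∈ A, ∀ b ∈ B, ¬ G.bidir a b) (v : (v : V) → D v) :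
    M.P.real (M.mechEvent (A ∪ B) v) =
      M.P.real (M.mechEvent A v) * M.P.real (M.mechEvent B v) := by
  -- the mechanism event of `C` in terms of the exogenous coordinates in `C` alone
  let T : (C : Finset V) → Set ((w : C) → E w) := fun C =>
    {g | ∀ w : C, M.f w (fun p => v p) (g w) = v w}
  have hT : ∀ C, MeasurableSet (T C) := by
    intro C
    have : T C = ⋂ w : C, (fun g => g w) ⁻¹' {e | M.f w (fun p => v p) e = v w} := by
      ext u
      simp [T]
    rw [this]
    exact MeasurableSet.iInter fun w => measurable_pi_apply w (M.f_meas _ _ _)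
  have hpre : ∀ C : Finset V, M.mechEvent C v = (fun u (a : C) => u a) ⁻¹' T C := by
    intro C
    ext u
    simp [mechEvent, T]
  have hU : M.mechEvent (A ∪ B) v = M.mechEvent A v ∩ M.mechEvent B v := by
    ext u
    simp only [mechEvent, mem_union, Set.mem_inter_iff, Set.mem_ofPred_eq]
    exact ⟨fun h => ⟨fun w hw => h w (.inl hw), fun w hw => h w (.inr hw)⟩,
      fun h w hw => hw.elim (h.1 w) (h.2 w)⟩
  have h := (M.indep A B hAB hb).measure_inter_preimage_eq_mul _ _ (hT A) (hT B)
  rw [← hpre, ← hpre, ← hU] at h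
  simp only [measureReal_def, h, ENNReal.toReal_mul]

theorem mechEvent_biUnion (T : Finset (Finset V))
    (hT : ∀ C ∈ T, ∀ C' ∈ T, C ≠ C' → Disjoint C C' ∧ ∀ a ∈ C, ∀ b ∈ C', ¬ G.bidir a b)
    (v : (v : V) → D v) :
    M.P.real (M.mechEvent (T.biUnion id) v) = ∏ C ∈ T, M.P.real (M.mechEvent C v) := by
  have := M.prob
  induction T using Finset.induction_on with
  | empty => simp [mechEvent]
  | insert C T hC ih =>
    have hne : ∀ C' ∈ T, C ≠ C' := fun C' h' h => hC (h ▸ h')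
    have hsep : ∀ C' ∈ T, Disjoint C C' ∧ ∀ a ∈ C, ∀ b ∈ C', ¬ G.bidir a b := fun C' h' =>
      hT C (mem_insert_self _ _) C' (mem_insert_of_mem h') (hne C' h')
    rw [biUnion_insert, prod_insert hC, id, mechEvent_union, ih]
    · exact fun C₁ h₁ C₂ h₂ => hT C₁ (mem_insert_of_mem h₁) C₂ (mem_insert_of_mem h₂)
    · exact (disjoint_biUnion_right _ _ _).2 fun C' h' => (hsep C' h').1
    · intro a ha b hb
      obtain ⟨C', h', hb'⟩ := mem_biUnion.1 hb
      exact (hsep C' h').2 a ha b hb'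

/-! ### Responses and c-factors -/

variable [Fintype V]

theorem response_of_mem {X : Finset V} (x : (v : V) → D v) (u : (v : V) → E v) {w : V}
    (h : w ∈ X) : M.response X x u w = x w := by
  rw [response, WellFounded.fix_eq, if_pos h]

theorem response_of_notMem {X : Finset V} (x : (v : V) → D v) (u : (v : V) → E v) {w : V}
    (h : w ∉ X) :
    M.response X x u w = M.f w (fun p => M.response X x u p) (u w) := by
  rw [response, WellFounded.fix_eq, if_neg h]

theorem response_congr {X : Finset V} {x x' : (v : V) → D v} (h : ∀ w ∈ X, x w = x' w)
    (u : (v : V) → E v) : M.response X x u = M.response X x' u := by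
  funext w
  induction w using G.dir_wf.induction with
  | _ w ih =>
    by_cases hw : w ∈ X
    · rw [response_of_mem _ _ _ hw, response_of_mem _ _ _ hw, h w hw]
    · rw [response_of_notMem _ _ _ hw, response_of_notMem _ _ _ hw]
      congr 1
      exact funext fun p => ih p p.2

/-- On a set `S` of vertices outside `X` whose parents lie in `S ∪ X`, the response to `do(X = v)`
is `v` if and only if the mechanisms of `S` are solved by `v`. -/
theorem response_eq_iff {X S : Finset V} (hS : ∀ w ∈ S, w ∉ X)
    (hpa : ∀ w ∈ S, ∀ p, G.dir p w → p ∉ X → p ∈ S) (v : (v : V) → D v) (u : (v : V) → E v) :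
    (∀ w ∈ S, M.response X v u w = v w) ↔ u ∈ M.mechEvent S v := by
  -- in either direction, the response at the parents of a vertex of `S` is known to be `v`
  have key : ∀ w ∈ S, (∀ p ∈ S, G.dir p w → M.response X v u p = v p) →
      M.response X v u w = M.f w (fun p => v p) (u w) := by
    intro w hw h
    rw [response_of_notMem _ _ _ (hS w hw)]
    congr 1
    funext p
    by_cases hp : p.1 ∈ X
    · exact response_of_mem _ _ _ hp
    · exact h p (hpa w hw p p.2 hp) p.2
  constructor
  · intro h w hw
    rw [← key w hw fun p hp _ => h p hp, h w hw]
  · intro h w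
    induction w using G.dir_wf.induction with
    | _ w ih =>
      intro hw
      rw [key w hw fun p hp hpw => ih p hpw hp]
      exact h w hw

theorem Q_eq_mechEvent (C : Finset V) (v : (v : V) → D v) :
    M.Q C v = M.P.real (M.mechEvent C v) := by
  rw [Q, doProb]
  congr 1
  ext u
  refine M.response_eq_iff (X := Cᶜ) (S := C) ?_ ?_ v u
  · simp
  · simp

theorem Q_nonneg (C : Finset V) (v : (v : V) → D v) : 0 ≤ M.Q C v :=
  measureReal_nonneg

theorem Q_le_of_subset {C C' : Finset V} (h : C ⊆ C') (v : (v : V) → D v) :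
    M.Q C' v ≤ M.Q C v := by
  have := M.prob
  rw [Q_eq_mechEvent, Q_eq_mechEvent]
  exact measureReal_mono (M.mechEvent_mono h v)

theorem Q_congr {C : Finset V} {v v' : (v : V) → D v} (h : ∀ w ∈ C, v w = v' w)
    (hpa : ∀ w ∈ C, ∀ p, G.dir p w → v p = v' p) : M.Q C v = M.Q C v' := by
  rw [Q_eq_mechEvent, Q_eq_mechEvent, M.mechEvent_congr h hpa]

theorem sum_Q_override_le_one [∀ v, Fintype (D v)] (C : Finset V) (v : (v : V) → D v) :
    ∑ c : ((w : C) → D w), M.Q C (override C c v) ≤ 1 := by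
  have := M.prob
  simp only [Q_eq_mechEvent]
  rw [← measureReal_biUnion_finset ?_ fun c _ => M.measurableSet_mechEvent _ _]
  · exact measureReal_le_one
  intro c _ c' _ hcc'
  refine Set.disjoint_left.2 fun u hu hu' => hcc' ?_
  -- the response to `do(V ∖ C = v)` does not depend on `c`, and it is `c` on `C`
  have hresp : ∀ c : ((w : C) → D w), u ∈ M.mechEvent C (override C c v) →
      ∀ w : C, M.response Cᶜ v u w = c w := by
    intro c hc w
    have h := (M.response_eq_iff (X := Cᶜ) (S := C) (by simp) (by simp) _ u).2 hc w w.2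
    rw [override_of_mem _ _ w.2] at h
    rw [← h]
    refine congrFun (M.response_congr (fun a ha => ?_) u) _
    rw [override_of_notMem _ _ (mem_compl.1 ha)]
  funext w
  rw [← hresp c hu w, hresp c' hu' w]

/-- The upper bound of `Q[C]` by `Q[C']`, `C ⊆ C'`. -/
theorem Q_add_sum_le [∀ v, Fintype (D v)] {C C' : Finset V} (h : C ⊆ C') (v : (v : V) → D v) :
    M.Q C v + ∑ c : ((w : C) → D w), M.Q C' (override C c v) ≤ M.Q C' v + 1 := by
  -- the differences `Q[C] - Q[C']` are nonnegative, so the one at `v` is at most their sum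
  have hle := single_le_sum (f := fun c : ((w : C) → D w) =>
      M.Q C (override C c v) - M.Q C' (override C c v))
    (fun c _ => sub_nonneg.2 (M.Q_le_of_subset h _)) (mem_univ fun w : C => v w)
  simp only [override_restrict, sum_sub_distrib] at hle
  linarith [M.sum_Q_override_le_one C v]

/-! ### The expected reward as a sum of products of c-factors -/

theorem prod_Q_cComponents (S : Finset V) (v : (v : V) → D v) :
    ∏ C : {C : Finset V // C ∈ G.cComponents S}, M.Q C.1 v = M.P.real (M.mechEvent S v) := by
  rw [Finset.prod_coe_sort (G.cComponents S) fun C => M.Q C v]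
  simp only [Q_eq_mechEvent]
  rw [← M.mechEvent_biUnion, G.biUnion_cComponents]
  exact fun C hC C' hC' hne => ⟨G.disjoint_of_mem_cComponents hC hC' hne,
    G.not_bidir_of_mem_cComponents hC hC' hne⟩

theorem doProb_le_one (X : Finset V) (x : (v : V) → D v) (A : Set ((v : V) → D v)) :
    M.doProb X x A ≤ 1 :=
  have := M.prob
  measureReal_le_one

theorem expReward_nonneg {Y : V} [Fintype (D Y)] {r : D Y → ℝ} (hr : ∀ y, 0 ≤ r y)
    (X : Finset V) (x : (v : V) → D v) : 0 ≤ M.expReward Y r X x :=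
  sum_nonneg fun y _ => mul_nonneg (hr y) measureReal_nonneg

variable {X : Finset V} {Y : V}

/-- A state solves the mechanisms of `Y⁺` at `s` if and only if its response to `do(X = x)` is `s`
on `Y⁺`. -/
theorem mem_mechEvent_ancUnder_iff (hY : Y ∉ X) {x b : (v : V) → D v} (hb : ∀ w ∈ X, b w = x w)
    (s : (w : G.ancUnder X Y) → D w) (u : (v : V) → E v) :
    u ∈ M.mechEvent (G.ancUnder X Y) (override (G.ancUnder X Y) s b) ↔
      (fun w : G.ancUnder X Y => M.response X x u w) = s := by
  have hX : ∀ w ∈ G.ancUnder X Y, w ∉ X := fun w => G.notMem_of_mem_ancUnder hY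
  rw [← M.response_eq_iff hX fun w hw p hp hpX => G.parent_mem_ancUnder hw hp hpX]
  have hr : M.response X (override (G.ancUnder X Y) s b) u = M.response X x u := by
    refine M.response_congr (fun w hw => ?_) u
    rw [override_of_notMem _ _ fun h => hX w h hw, hb w hw]
  rw [hr, funext_iff, Subtype.forall]
  refine forall₂_congr fun w hw => ?_
  rw [override_of_mem _ _ hw]

variable [∀ v, Fintype (D v)]

theorem setOf_response_reward_eq (hY : Y ∉ X) {x b : (v : V) → D v} (hb : ∀ w ∈ X, b w = x w)
    (y : D Y) :
    {u | M.response X x u ∈ {d : (v : V) → D v | d Y = y}} =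
      ⋃ s ∈ univ.filter fun s : (w : G.ancUnder X Y) → D w =>
          s ⟨Y, G.self_mem_ancUnder X Y⟩ = y,
        M.mechEvent (G.ancUnder X Y) (override (G.ancUnder X Y) s b) := by
  ext u
  simp [M.mem_mechEvent_ancUnder_iff hY hb]

theorem doProb_reward_eq_sum (hY : Y ∉ X) {x b : (v : V) → D v} (hb : ∀ w ∈ X, b w = x w)
    (y : D Y) :
    M.doProb X x {d | d Y = y} =
      ∑ s : ((w : G.ancUnder X Y) → D w) with s ⟨Y, G.self_mem_ancUnder X Y⟩ = y,
        ∏ C : {C : Finset V // C ∈ G.cComponents (G.ancUnder X Y)},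
          M.Q C.1 (override (G.ancUnder X Y) s b) := by
  have := M.prob
  simp only [prod_Q_cComponents]
  rw [← measureReal_biUnion_finset ?_ fun c _ => M.measurableSet_mechEvent _ _, doProb,
    M.setOf_response_reward_eq hY hb]
  intro s _ s' _ hne
  refine Set.disjoint_left.2 fun u hu hu' => hne ?_
  rw [← (M.mem_mechEvent_ancUnder_iff hY hb s u).1 hu,
    (M.mem_mechEvent_ancUnder_iff hY hb s' u).1 hu']

theorem expReward_eq_sum (hY : Y ∉ X) (r : D Y → ℝ) {x b : (v : V) → D v}
    (hb : ∀ w ∈ X, b w = x w) :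
    M.expReward Y r X x =
      ∑ s : ((w : G.ancUnder X Y) → D w), r (s ⟨Y, G.self_mem_ancUnder X Y⟩) *
        ∏ C : {C : Finset V // C ∈ G.cComponents (G.ancUnder X Y)},
          M.Q C.1 (override (G.ancUnder X Y) s b) := by
  rw [expReward, ← Finset.sum_fiberwise univ
    fun s : ((w : G.ancUnder X Y) → D w) => s ⟨Y, G.self_mem_ancUnder X Y⟩]
  refine sum_congr rfl fun y _ => ?_
  rw [M.doProb_reward_eq_sum hY hb, mul_sum]
  refine sum_congr rfl fun s hs => ?_
  rw [(mem_filter.1 hs).2]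

theorem sum_doProb_reward_le_one (hY : Y ∉ X) (x : (v : V) → D v) :
    ∑ y, M.doProb X x {d | d Y = y} ≤ 1 := by
  have := M.prob
  simp only [doProb]
  rw [← measureReal_biUnion_finset]
  · exact measureReal_le_one
  · exact fun y _ y' _ hne => Set.disjoint_left.2 fun u (hu : _ = _) (hu' : _ = _) =>
      hne (hu.symm.trans hu')
  · intro y _
    rw [M.setOf_response_reward_eq hY fun _ _ => rfl]
    exact Finset.measurableSet_biUnion _ fun s _ => M.measurableSet_mechEvent _ _

end SCM

/-! ### Transport from the sources and the factor bounds -/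

namespace Environments

variable {V : Type*} [Fintype V] {n : ℕ} {𝒢 : SelectionDiagram V n} {D : V → Type*}
  (𝓜 : Environments 𝒢 D)

theorem target_Q_eq_source_Q {C : Finset V} {i : Fin n} (h : Disjoint C (𝒢.Δ i))
    (v : (v : V) → D v) : 𝓜.target.Q C v = (𝓜.source i).Q C v := by
  have hC : ∀ w ∈ C, w ∉ 𝒢.Δ i := fun w hw => Finset.disjoint_left.1 h hw
  -- the mechanism event of `C`, in terms of the exogenous coordinates outside `Δ i` alone
  let T : Set ((w : {w // w ∉ 𝒢.Δ i}) → 𝓜.E w) :=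
    ⋂ w : C, (fun g => g ⟨w, hC w w.2⟩) ⁻¹' {e | 𝓜.target.f w (fun p => v p) e = v w}
  have hT : MeasurableSet T := MeasurableSet.iInter fun w =>
    measurable_pi_apply (⟨w, hC w w.2⟩ : {w // w ∉ 𝒢.Δ i}) (𝓜.target.f_meas _ _ _)
  have hm : Measurable fun (u : (v : V) → 𝓜.E v) (w : {w // w ∉ 𝒢.Δ i}) => u w :=
    measurable_pi_lambda _ fun w => measurable_pi_apply w.1
  have ht : 𝓜.target.mechEvent C v = (fun u (w : {w // w ∉ 𝒢.Δ i}) => u w) ⁻¹' T := by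
    ext u
    simp [SCM.mechEvent, T]
  have hs : (𝓜.source i).mechEvent C v = 𝓜.target.mechEvent C v := by
    ext u
    refine forall₂_congr fun w hw => ?_
    rw [𝓜.f_eq i w (hC w hw)]
  rw [SCM.Q_eq_mechEvent, SCM.Q_eq_mechEvent, hs, ht, measureReal_def, measureReal_def,
    ← Measure.map_apply hm hT, ← Measure.map_apply hm hT, 𝓜.law_eq]

theorem transportable_of_isCounterpart {𝒵 : Fin n → Set (Finset V)} {i : Fin n} {C : Finset V}
    (h : IsCounterpart 𝒢 D 𝒵 i C) : Transportable 𝒢 D 𝒵 C := by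
  intro 𝓜 𝓝 hM hN hdata v
  rw [𝓜.target_Q_eq_source_Q h.1, 𝓝.target_Q_eq_source_Q h.1]
  exact h.2 _ _ _ _ (hM i) (hN i) (hdata i) v

end Environments

namespace SourceChoice

variable {V : Type*} [Fintype V] {n : ℕ} {𝒢 : SelectionDiagram V n} {D : V → Type*}
  {𝒵 : Fin n → Set (Finset V)} {Y : V} {X : Finset V} {x : (v : V) → D v}
  (p : SourceChoice 𝒢 D 𝒵 Y X x) (𝓜 : Environments 𝒢 D)

/-- The source factor `Q[C]` at the chosen fill-in values is the target factor: parents of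
`C ⊆ Y⁺` lie in `X ∪ Y⁺`, so the fill-in values do not matter. -/
theorem source_Q_fill (C : Factor 𝒢 Y X) (s : YPlus 𝒢 D Y X) {b : (v : V) → D v}
    (hb : ∀ w ∈ X, b w = x w) (hY : Y ∉ X) :
    (𝓜.source (p.src C)).Q C.1 (p.fill C s) =
      𝓜.target.Q C.1 (override (𝒢.ancUnder X Y) s b) := by
  rw [𝓜.target_Q_eq_source_Q (p.disjoint_src C)]
  have hC := 𝒢.subset_of_mem_cComponents C.2
  have hfill : ∀ w ∈ 𝒢.ancUnder X Y,
      p.fill C s w = override (𝒢.ancUnder X Y) s b w := by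
    intro w hw
    rw [override_of_mem _ _ hw]
    exact p.fill_yplus C s ⟨w, hw⟩
  refine SCM.Q_congr _ (fun w hw => hfill w (hC hw)) fun w hw a ha => ?_
  by_cases haX : a ∈ X
  · rw [override_of_notMem _ _ fun h => 𝒢.notMem_of_mem_ancUnder hY h haX,
      p.fill_action C s a haX, hb a haX]
  · exact hfill a (𝒢.parent_mem_ancUnder (hC hw) ha haX)

theorem lowerFactor_nonneg (C : Factor 𝒢 Y X) (s : YPlus 𝒢 D Y X) : 0 ≤ p.lowerFactor 𝓜 C s :=
  SCM.Q_nonneg _ _ _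

theorem lowerFactor_le (hY : Y ∉ X) (C : Factor 𝒢 Y X) (s : YPlus 𝒢 D Y X)
    {b : (v : V) → D v} (hb : ∀ w ∈ X, b w = x w) :
    p.lowerFactor 𝓜 C s ≤ 𝓜.target.Q C.1 (override (𝒢.ancUnder X Y) s b) := by
  rw [← p.source_Q_fill 𝓜 C s hb hY]
  exact SCM.Q_le_of_subset _ (p.subset_big C) _

theorem source_Q_big_eq {𝓜 𝓝 : Environments 𝒢 D} (hM : 𝓜.Positive) (hN : 𝓝.Positive)
    (h : 𝓜.SameData 𝒵 𝓝) (C : Factor 𝒢 Y X) :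
    (𝓜.source (p.src C)).Q (p.big C) = (𝓝.source (p.src C)).Q (p.big C) :=
  funext fun v => p.identifiable C _ _ _ _ (hM _) (hN _) (h _) v

variable [∀ v, Fintype (D v)]

theorem le_upperFactor (hY : Y ∉ X) (C : Factor 𝒢 Y X) (s : YPlus 𝒢 D Y X)
    {b : (v : V) → D v} (hb : ∀ w ∈ X, b w = x w) :
    𝓜.target.Q C.1 (override (𝒢.ancUnder X Y) s b) ≤ p.upperFactor 𝓜 C s := by
  rw [← p.source_Q_fill 𝓜 C s hb hY, upperFactor]
  split_ifs with h
  · exact le_rfl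
  · exact le_sub_iff_add_le.2 (SCM.Q_add_sum_le _ (p.subset_big C) _)

/-! ### The bounds of the expected reward -/

theorem lower_le_expReward (hY : Y ∉ X) {r : D Y → ℝ} (hr : ∀ y, 0 ≤ r y) :
    p.lower 𝓜 r ≤ 𝓜.target.expReward Y r X x := by
  rw [𝓜.target.expReward_eq_sum hY r (b := x) fun _ _ => rfl]
  refine sum_le_sum fun s _ => mul_le_mul_of_nonneg_left ?_ (hr _)
  exact prod_le_prod (fun C _ => p.lowerFactor_nonneg 𝓜 C s)
    fun C _ => p.lowerFactor_le 𝓜 hY C s fun _ _ => rfl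

theorem expReward_le_upper (hY : Y ∉ X) {r : D Y → ℝ} (hr : ∀ y, 0 ≤ r y) :
    𝓜.target.expReward Y r X x ≤ p.upper 𝓜 r := by
  refine sum_le_sum fun y _ => mul_le_mul_of_nonneg_left ?_ (hr _)
  refine le_min (𝓜.target.doProb_le_one _ _ _) ?_
  rw [𝓜.target.doProb_reward_eq_sum hY (b := x) fun _ _ => rfl]
  exact sum_le_sum fun s _ => prod_le_prod (fun C _ => SCM.Q_nonneg _ _ _)
    fun C _ => p.le_upperFactor 𝓜 hY C s fun _ _ => rfl

variable {𝓜} {𝓝 : Environments 𝒢 D}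

theorem lower_eq_of_sameData (hM : 𝓜.Positive) (hN : 𝓝.Positive) (h : 𝓜.SameData 𝒵 𝓝)
    (r : D Y → ℝ) : p.lower 𝓜 r = p.lower 𝓝 r := by
  simp only [lower, lowerFactor, p.source_Q_big_eq hM hN h]

theorem upper_eq_of_sameData (hM : 𝓜.Positive) (hN : 𝓝.Positive) (h : 𝓜.SameData 𝒵 𝓝)
    (r : D Y → ℝ) : p.upper 𝓜 r = p.upper 𝓝 r := by
  have hU : ∀ C s, p.upperFactor 𝓜 C s = p.upperFactor 𝓝 C s := by
    intro C s
    have hQ := p.source_Q_big_eq hM hN h C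
    rw [upperFactor, upperFactor]
    split_ifs with hC
    · rw [← hC, hQ]
    · rw [hQ]
  simp only [upper, hU]

end SourceChoice

theorem mainTheorem1 {V : Type*} [Fintype V] {n : ℕ} (𝒢 : SelectionDiagram V n)
    (D : V → Type*) [∀ v, Fintype (D v)] (𝒵 : Fin n → Set (Finset V))
    (Y : V) (r : D Y → ℝ) (hr : ∀ y, 0 ≤ r y)
    (X : Finset V) (hY : Y ∉ X) (x : (v : V) → D v) (𝓜 : Environments 𝒢 D) :
    -- decomposition of the target expected reward into c-factors
    (∀ b : (v : V) → D v, (∀ w ∈ X, b w = x w) →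
      𝓜.target.expReward Y r X x =
        ∑ s : YPlus 𝒢 D Y X, r s.reward *
          ∏ C : Factor 𝒢 Y X, 𝓜.target.Q C.1 (override (𝒢.ancUnder X Y) s b)) ∧
    -- source counterparts equal the target c-factors, which are then transportable
    (∀ (C : Factor 𝒢 Y X) (i : Fin n), IsCounterpart 𝒢 D 𝒵 i C.1 →
      Transportable 𝒢 D 𝒵 C.1 ∧ ∀ v, 𝓜.target.Q C.1 v = (𝓜.source i).Q C.1 v) ∧
    -- bounds of each target c-factor by the chosen source c-factor
    (∀ (p : SourceChoice 𝒢 D 𝒵 Y X x) (C : Factor 𝒢 Y X) (s : YPlus 𝒢 D Y X)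
        (b : (v : V) → D v), (∀ w ∈ X, b w = x w) →
      p.lowerFactor 𝓜 C s ≤ 𝓜.target.Q C.1 (override (𝒢.ancUnder X Y) s b) ∧
      𝓜.target.Q C.1 (override (𝒢.ancUnder X Y) s b) ≤ p.upperFactor 𝓜 C s) ∧
    -- bounds of the target expected reward for every choice of source c-factors
    (∀ p : SourceChoice 𝒢 D 𝒵 Y X x,
      p.lower 𝓜 r ≤ 𝓜.target.expReward Y r X x ∧
      𝓜.target.expReward Y r X x ≤ p.upper 𝓜 r) ∧
    -- validity of the optimized causal bounds
    lowerCausalBound 𝓜 𝒵 Y r X x ≤ (𝓜.target.expReward Y r X x : EReal) ∧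
    (𝓜.target.expReward Y r X x : EReal) ≤ upperCausalBound 𝓜 𝒵 Y r X x ∧
    ((∀ y, r y ≤ 1) →
      (𝓜.target.expReward Y r X x : EReal) ≤ min 1 (upperCausalBound 𝓜 𝒵 Y r X x)) ∧
    -- the causal bounds are determined by the available source distributions
    (∀ 𝓝 : Environments 𝒢 D, 𝓜.Positive → 𝓝.Positive → 𝓜.SameData 𝒵 𝓝 →
      lowerCausalBound 𝓜 𝒵 Y r X x = lowerCausalBound 𝓝 𝒵 Y r X x ∧
      upperCausalBound 𝓜 𝒵 Y r X x = upperCausalBound 𝓝 𝒵 Y r X x) := by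
  have hupper : (𝓜.target.expReward Y r X x : EReal) ≤ upperCausalBound 𝓜 𝒵 Y r X x :=
    le_iInf fun p => EReal.coe_le_coe_iff.2 (p.expReward_le_upper 𝓜 hY hr)
  refine ⟨fun b hb => 𝓜.target.expReward_eq_sum hY r hb, fun C i h =>
    ⟨Environments.transportable_of_isCounterpart h, 𝓜.target_Q_eq_source_Q h.1⟩,
    fun p C s b hb => ⟨p.lowerFactor_le 𝓜 hY C s hb, p.le_upperFactor 𝓜 hY C s hb⟩,
    fun p => ⟨p.lower_le_expReward 𝓜 hY hr, p.expReward_le_upper 𝓜 hY hr⟩,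
    max_le ?_ (iSup_le fun p => EReal.coe_le_coe_iff.2 (p.lower_le_expReward 𝓜 hY hr)),
    hupper, fun hr1 => le_min ?_ hupper, fun 𝓝 hM hN h => ⟨?_, ?_⟩⟩
  · exact EReal.coe_nonneg.2 (𝓜.target.expReward_nonneg hr X x)
  · have h1 : 𝓜.target.expReward Y r X x ≤ 1 :=
      (sum_le_sum fun y _ => mul_le_of_le_one_left measureReal_nonneg (hr1 y)).trans
        (𝓜.target.sum_doProb_reward_le_one hY x)
    exact_mod_cast h1
  · simp only [lowerCausalBound, SourceChoice.lower_eq_of_sameData _ hM hN h]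
  · simp only [upperCausalBound, SourceChoice.upper_eq_of_sameData _ hM hN h]
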